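/- Assume the generalized continuum hypothesis ($2^\kappa=\kappa^+$ for every infinite cardinal $\kappa$). Let $X$ be a homogeneous compactum, i.e. a compact Hausdorff space such that for all $x,y\in X$ some homeomorphism $h\colon X\to X$ satisfies $h(x)=y$. Then $\chi Nt(X)\le c(X)$; that is, every point of $X$ has a local base that is $c(X)^{\mathrm{op}}$-like. Here, for a cardinal $\kappa$, a family $\mathcal B$ of sets, ordered by inclusion, is $\kappa^{\mathrm{op}}$-like if no element of $\mathcal B$ is contained in $\kappa$-many elements of $\mathcal B$. A local base at a point $p$ is a family of open sets containing $p$ such that every open set containing $p$ includes a member of the family. The local Noetherian type $\chi Nt(p,X)$ of a point $p$ is the least infinite cardinal $\kappa$ such that $p$ has a $\kappa^{\mathrm{op}}$-like local base, and $\chi Nt(X)=\sup_{p\in X}\chi Nt(p,X)$. The cellularity $c(X)$ is the maximum of $\aleph_0$ and the supremum of the cardinalities of the pairwise disjoint families of nonempty open subsets of $X$. -/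

import Mathlib

universe u

open Cardinal

namespace NoetherianType

/-- The generalized continuum hypothesis, for the cardinals of the universe `u`. -/
def GCH : Prop :=
  ∀ κ : Cardinal.{u}, ℵ₀ ≤ κ → (2 : Cardinal.{u}) ^ κ = Order.succ κ

/-- A poset `P` is `κ^op`-like if no element of `P` is below `κ`-many elements of `P`. -/
def IsOpLike (κ : Cardinal.{u}) (P : Type u) [PartialOrder P] : Prop :=
  ∀ p : P, ¬ κ ≤ #{q : P // p ≤ q}

/-- A space is homogeneous if its autohomeomorphisms act transitively on its points. -/
def IsHomogeneous (X : Type u) [TopologicalSpace X] : Prop :=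
  ∀ x y : X, ∃ h : X ≃ₜ X, h x = y

/-- A family `𝓑` of subsets of `X` is a neighborhood base of the subset `E`: its members are open
sets containing `E`, and every open set containing `E` contains a member of `𝓑`.
A local base at a point `p` is a neighborhood base of `{p}`. -/
structure IsNbhdBase {X : Type u} [TopologicalSpace X] (E : Set X) (𝓑 : Set (Set X)) : Prop where
  isOpen : ∀ U ∈ 𝓑, IsOpen U
  subset : ∀ U ∈ 𝓑, E ⊆ U
  exists_subset : ∀ V : Set X, IsOpen V → E ⊆ V → ∃ U ∈ 𝓑, U ⊆ V

/-- The local Noetherian type `χNt(E, X)` of a subset `E` of `X`: the least infinite cardinal `κ`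
such that `E` has a neighborhood base which, ordered by inclusion, is `κ^op`-like. -/
noncomputable def setLocalNoetherianType {X : Type u} [TopologicalSpace X] (E : Set X) :
    Cardinal.{u} :=
  sInf {κ : Cardinal.{u} | ℵ₀ ≤ κ ∧ ∃ 𝓑 : Set (Set X), IsNbhdBase E 𝓑 ∧ IsOpLike κ 𝓑}

/-- The local Noetherian type `χNt(X)` of a space: the supremum of the local Noetherian types of
its points. -/
noncomputable def localNoetherianType (X : Type u) [TopologicalSpace X] : Cardinal.{u} :=
  ⨆ p : X, setLocalNoetherianType ({p} : Set X)

/-- A cellular family: a pairwise disjoint family of nonempty open sets. -/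
structure IsCellularFamily {X : Type u} [TopologicalSpace X] (𝓒 : Set (Set X)) : Prop where
  isOpen : ∀ U ∈ 𝓒, IsOpen U
  nonempty : ∀ U ∈ 𝓒, U.Nonempty
  pairwiseDisjoint : 𝓒.Pairwise Disjoint

/-- The cellularity `c(X)`: the supremum of the cardinalities of the cellular families of `X`,
and at least `ℵ₀`, by the usual convention that cardinal functions take infinite values. -/
noncomputable def cellularity (X : Type u) [TopologicalSpace X] : Cardinal.{u} :=
  max ℵ₀ (⨆ 𝓒 : {𝓒 : Set (Set X) // IsCellularFamily 𝓒}, #(𝓒 : Set (Set X)))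

end NoetherianType

/-!
Let `χ` and `πχ` be the character and the π-character of the points of the homogeneous compactum
`X`; by homogeneity they do not depend on the point. The proof compares `χ` with `c(X)`.

If `χ ≤ c(X)`, it suffices that a point of infinite character `χ` has a `χ^op`-like local base
(`exists_isOpLike_character`), which is obtained by shrinking the members of a base one after the
other so that none contains an earlier one.

If `c(X) < χ`, then GCH forces `χ = πχ`. Indeed, put `μ = max (c(X)) πχ`. By homogeneity
`|X| ≤ 2 ^ μ = μ⁺` (`IsHomogeneous.mk_le`), whereas a compactum with at most `μ⁺` points has a
point of character at most `μ` (`exists_character_le`); hence `χ ≤ μ`.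

When `χ = πχ = κ` is uncountable, each point even has an `ℵ₀^op`-like local base. It is enough to
find `κ` many neighborhoods of the point such that no neighborhood is included in infinitely many
of them (`HasPointFiniteNbhds`), and to intersect the members of a base of size `κ` with them. For
regular `κ`, an argument of Šapirovskiĭ gives an independent family of `κ` many pairs of open sets
with disjoint closures (`exists_independent_pairs`). It is built by recursion: fewer than `πχ` many
open sets can be split simultaneously, though only below one of them, and a pressing-down argument
makes that one constant on `κ` many stages. Any point of a minimal closed set meeting all the
intersections of choices from the pairs is then as required
(`exists_hasPointFiniteNbhds_of_independent`). For singular `κ`, families for smaller regular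
cardinals exist at one and the same point by homogeneity, and they are combined along a cofinal
set (`IsHomogeneous.hasPointFiniteNbhds`).
-/

namespace NoetherianType

/-! ### Recursion and pressing down on regular cardinals -/

/-- Transfinite construction of a sequence in which each term is only required to stand in a
given (always satisfiable) relation to the earlier ones. -/
theorem exists_forall_of_wellFoundedLT {I : Type*} [LT I] [WellFoundedLT I] {Y : Type*}
    (P : ∀ i : I, (∀ j, j < i → Y) → Y → Prop) (h : ∀ i g, ∃ y, P i g y) :
    ∃ f : I → Y, ∀ i, P i (fun j _ => f j) (f i) := by
  choose F hF using h
  refine ⟨(wellFounded_lt (α := I)).fix F, fun i => ?_⟩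
  rw [WellFounded.fix_eq]
  exact hF _ _

theorem mk_Iio_ord_lt {κ : Cardinal.{u}} (i : κ.ord.ToType) : #(Set.Iio i) < κ := by
  simpa using mk_Iio_lt i (by simp)

theorem exists_forall_lt_of_mk_lt {κ : Cardinal.{u}} (hκ : κ.IsRegular) {S : Set κ.ord.ToType}
    (hS : #S < κ) : ∃ b, ∀ x ∈ S, x < b := by
  by_contra! H
  have hc : IsCofinal S := H
  have h := Order.cof_le hc
  rw [Ordinal.cof_toType, hκ.cof_ord] at h
  exact absurd hS h.not_gt

theorem exists_forall_range_lt {κ : Cardinal.{u}} (hκ : κ.IsRegular) {J : Type u}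
    (hJ : #J < κ) (f : J → κ.ord.ToType) : ∃ b, ∀ j, f j < b := by
  obtain ⟨b, hb⟩ := exists_forall_lt_of_mk_lt hκ (S := Set.range f) (mk_range_le.trans_lt hJ)
  exact ⟨b, fun j => hb _ ⟨j, rfl⟩⟩

theorem mk_finset_lt {κ : Cardinal.{u}} (hκ : ℵ₀ < κ) {J : Type u} (hJ : #J < κ) :
    #(Finset J) < κ := by
  cases fintypeOrInfinite J
  · exact (lt_aleph0_of_finite _).trans hκ
  · rwa [mk_finset_of_infinite]

/-- The subtype consists of the finite subsets of `S ×ˢ univ`, kept inside `Finset (I × Bool)`. -/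
theorem mk_finset_prod_bool_lt {κ : Cardinal.{u}} (hκ : ℵ₀ < κ) {I : Type u} {S : Set I}
    (hS : #S < κ) : #{s : Finset (I × Bool) // ∀ x ∈ s, x.1 ∈ S} < κ := by
  have h2 : #(S × Bool) < κ := by
    rw [mk_prod]
    simp only [lift_uzero, mk_bool, lift_ofNat]
    exact mul_lt_of_lt hκ.le hS ((natCast_lt_aleph0 (n := 2)).trans hκ)
  refine lt_of_le_of_lt ?_ (mk_finset_lt hκ h2)
  classical
  refine mk_le_of_surjective (f := fun t : Finset (S × Bool) =>
    ⟨t.image fun x => ((x.1 : I), x.2), ?_⟩) ?_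
  · intro x hx
    obtain ⟨y, _, rfl⟩ := Finset.mem_image.1 hx
    exact y.1.2
  · rintro ⟨s, hs⟩
    refine ⟨s.attach.image fun x => (⟨x.1.1, hs _ x.2⟩, x.1.2), ?_⟩
    ext ⟨i, b⟩
    cases b <;> simpa using hs (i, _)

/-- A pressing-down principle for finite sets: if each index `i` below a regular uncountable cardinal
`κ` is assigned a finite set of earlier indices, each with a label, then one and the same finite
set is assigned to `κ` many indices. Otherwise each finite set is assigned to boundedly many
indices only, and some `δ` is closed under the map `g` bounding the indices to which sets from a
given initial segment are assigned; but the set assigned to `δ` lies below some point less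
than `δ`. -/
theorem exists_mk_fiber_of_regressive {κ : Cardinal.{u}} (hκ : κ.IsRegular) (h0 : ℵ₀ < κ)
    (t : κ.ord.ToType → Finset (κ.ord.ToType × Bool)) (ht : ∀ i, ∀ x ∈ t i, x.1 < i) :
    ∃ s, #{i // t i = s} = κ := by
  by_contra! H
  have hlt : ∀ s, ∃ b, ∀ i, t i = s → i < b := fun s =>
    exists_forall_lt_of_mk_lt hκ (S := {i | t i = s}) <| lt_of_le_of_ne
      ((mk_set_le _).trans_eq (mk_ord_toType κ)) (H s)
  choose b hb using hlt
  have hg : ∀ β : κ.ord.ToType, ∃ γ, β < γ ∧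
      ∀ s : Finset (κ.ord.ToType × Bool), (∀ x ∈ s, x.1 < β) → b s < γ := by
    intro β
    obtain ⟨γ, hγ⟩ := exists_forall_range_lt hκ
      (mk_finset_prod_bool_lt h0 (mk_Iio_ord_lt β)) (fun s => b s.1)
    -- a strict upper bound of both `β` and `γ`
    obtain ⟨γ', hγ'⟩ := exists_forall_range_lt (J := ULift.{u} Bool) hκ
      ((lt_aleph0_of_finite _).trans h0) (fun x => if x.down then β else γ)
    have h1 := hγ' ⟨true⟩
    have h2 := hγ' ⟨false⟩
    simp only [if_true, Bool.false_eq_true, if_false] at h1 h2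
    exact ⟨γ', h1, fun s hs => (hγ ⟨s, hs⟩).trans h2⟩
  choose g hg1 hg2 using hg
  obtain ⟨i0, -⟩ := exists_forall_lt_of_mk_lt hκ (S := ∅) (by simpa using hκ.pos)
  let β : ℕ → κ.ord.ToType := fun n => g^[n] i0
  have hβ : ∀ n, β (n + 1) = g (β n) := fun n => Function.iterate_succ_apply' g n i0
  have hmono : StrictMono β := strictMono_nat_of_lt_succ fun n => by rw [hβ]; exact hg1 _
  -- `δ` is the supremum of the `β n`, a point closed under `g`
  obtain ⟨δ, hδ, hmin⟩ := (wellFounded_lt (α := κ.ord.ToType)).has_min {δ | ∀ n, β n < δ} (by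
    obtain ⟨d, hd⟩ := exists_forall_range_lt (J := ULift.{u} ℕ) hκ (by simpa using h0)
      (fun n => β n.down)
    exact ⟨d, fun n => hd ⟨n⟩⟩)
  have hN : ∃ N, ∀ x ∈ t δ, x.1 < β N := by
    have : ∀ x ∈ t δ, ∃ n, x.1 < β n := by
      intro x hx
      have := hmin x.1
      by_contra! hcon
      refine this ?_ (ht δ x hx)
      intro n
      exact (hmono n.lt_succ_self).trans_le (hcon _)
    choose! n hn using this
    refine ⟨(t δ).sup n, fun x hx => (hn x hx).trans_le (hmono.monotone (Finset.le_sup hx))⟩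
  obtain ⟨N, hN⟩ := hN
  have h1 := hg2 (β N) (t δ) hN
  rw [← hβ] at h1
  exact lt_asymm ((hb _ δ rfl).trans h1) (hδ _)

/-! ### Characters and local π-bases -/

section Character

variable {X : Type u} [TopologicalSpace X]

/-- A local π-base at `p`: a family of nonempty open sets such that every open set containing `p`
includes a member of the family. The members need not contain `p`. -/
structure IsLocalPiBase (p : X) (𝓑 : Set (Set X)) : Prop where
  isOpen : ∀ U ∈ 𝓑, IsOpen U
  nonempty : ∀ U ∈ 𝓑, U.Nonempty
  exists_subset : ∀ V : Set X, IsOpen V → p ∈ V → ∃ U ∈ 𝓑, U ⊆ V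

/-- The character of `p`: the least cardinality of a local base. Finite values are allowed. -/
noncomputable def character (p : X) : Cardinal.{u} :=
  sInf {κ | ∃ 𝓑 : Set (Set X), IsNbhdBase {p} 𝓑 ∧ #𝓑 = κ}

/-- The π-character of `p`: the least cardinality of a local π-base. -/
noncomputable def piCharacter (p : X) : Cardinal.{u} :=
  sInf {κ | ∃ 𝓑 : Set (Set X), IsLocalPiBase p 𝓑 ∧ #𝓑 = κ}

theorem isNbhdBase_all (p : X) : IsNbhdBase {p} {U : Set X | IsOpen U ∧ p ∈ U} where
  isOpen _ h := h.1
  subset _ h := Set.singleton_subset_iff.2 h.2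
  exists_subset V hV hp := ⟨V, ⟨hV, hp rfl⟩, subset_rfl⟩

theorem IsNbhdBase.isLocalPiBase {p : X} {𝓑 : Set (Set X)} (h : IsNbhdBase {p} 𝓑) :
    IsLocalPiBase p 𝓑 where
  isOpen := h.isOpen
  nonempty U hU := ⟨p, h.subset U hU rfl⟩
  exists_subset V hV hp := h.exists_subset V hV (Set.singleton_subset_iff.2 hp)

theorem exists_mk_eq_character (p : X) :
    ∃ 𝓑 : Set (Set X), IsNbhdBase {p} 𝓑 ∧ #𝓑 = character p :=
  csInf_mem (s := {κ | ∃ 𝓑 : Set (Set X), IsNbhdBase {p} 𝓑 ∧ #𝓑 = κ})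
    ⟨_, _, isNbhdBase_all p, rfl⟩

theorem exists_mk_eq_piCharacter (p : X) :
    ∃ 𝓑 : Set (Set X), IsLocalPiBase p 𝓑 ∧ #𝓑 = piCharacter p :=
  csInf_mem (s := {κ | ∃ 𝓑 : Set (Set X), IsLocalPiBase p 𝓑 ∧ #𝓑 = κ})
    ⟨_, _, (isNbhdBase_all p).isLocalPiBase, rfl⟩

theorem character_le {p : X} {𝓑 : Set (Set X)} (h : IsNbhdBase {p} 𝓑) : character p ≤ #𝓑 :=
  csInf_le' ⟨𝓑, h, rfl⟩

theorem piCharacter_le {p : X} {𝓑 : Set (Set X)} (h : IsLocalPiBase p 𝓑) :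
    piCharacter p ≤ #𝓑 :=
  csInf_le' ⟨𝓑, h, rfl⟩

theorem IsNbhdBase.image {Y : Type u} [TopologicalSpace Y] (h : X ≃ₜ Y) {p : X}
    {𝓑 : Set (Set X)} (hB : IsNbhdBase {p} 𝓑) :
    IsNbhdBase {h p} ((fun U => h '' U) '' 𝓑) where
  isOpen := by
    rintro _ ⟨U, hU, rfl⟩
    exact h.isOpenMap _ (hB.isOpen U hU)
  subset := by
    rintro _ ⟨U, hU, rfl⟩
    exact Set.singleton_subset_iff.2 ⟨p, hB.subset U hU rfl, rfl⟩
  exists_subset V hV hp := by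
    obtain ⟨U, hU, hUV⟩ := hB.exists_subset (h ⁻¹' V) (hV.preimage h.continuous)
      (Set.singleton_subset_iff.2 (hp rfl))
    exact ⟨_, ⟨U, hU, rfl⟩, Set.image_subset_iff.2 hUV⟩

theorem IsLocalPiBase.image {Y : Type u} [TopologicalSpace Y] (h : X ≃ₜ Y) {p : X}
    {𝓑 : Set (Set X)} (hB : IsLocalPiBase p 𝓑) :
    IsLocalPiBase (h p) ((fun U => h '' U) '' 𝓑) where
  isOpen := by
    rintro _ ⟨U, hU, rfl⟩
    exact h.isOpenMap _ (hB.isOpen U hU)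
  nonempty := by
    rintro _ ⟨U, hU, rfl⟩
    exact (hB.nonempty U hU).image _
  exists_subset V hV hp := by
    obtain ⟨U, hU, hUV⟩ := hB.exists_subset (h ⁻¹' V) (hV.preimage h.continuous) hp
    exact ⟨_, ⟨U, hU, rfl⟩, Set.image_subset_iff.2 hUV⟩

theorem IsHomogeneous.character_eq (hX : IsHomogeneous X) (p q : X) :
    character p = character q := by
  have key : ∀ p q : X, character q ≤ character p := by
    intro p q
    obtain ⟨h, rfl⟩ := hX p q
    obtain ⟨𝓑, hB, hc⟩ := exists_mk_eq_character p
    exact (character_le (hB.image h)).trans (mk_image_le.trans_eq hc)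
  exact le_antisymm (key q p) (key p q)

theorem IsHomogeneous.piCharacter_eq (hX : IsHomogeneous X) (p q : X) :
    piCharacter p = piCharacter q := by
  have key : ∀ p q : X, piCharacter q ≤ piCharacter p := by
    intro p q
    obtain ⟨h, rfl⟩ := hX p q
    obtain ⟨𝓑, hB, hc⟩ := exists_mk_eq_piCharacter p
    exact (piCharacter_le (hB.image h)).trans (mk_image_le.trans_eq hc)
  exact le_antisymm (key q p) (key p q)

theorem IsOpLike.mono {P : Type u} [PartialOrder P] {κ μ : Cardinal.{u}} (h : IsOpLike κ P)
    (hκ : κ ≤ μ) : IsOpLike μ P := fun p hp => h p (hκ.trans hp)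

theorem isOpLike_of_mk_lt {P : Type u} [PartialOrder P] {κ : Cardinal.{u}} (h : #P < κ) :
    IsOpLike κ P := fun _ hp => (hp.trans (mk_subtype_le _)).not_gt h

/-- A point of infinite character `χ` has a `χ^op`-like local base. Along an enumeration of a local
base in type `χ`, each member is shrunk so as to contain none of the earlier ones; this is possible
because fewer than `χ` sets never form a local base. -/
theorem exists_isOpLike_character (p : X) (h0 : ℵ₀ ≤ character p) :
    ∃ 𝓑 : Set (Set X), IsNbhdBase {p} 𝓑 ∧ IsOpLike (character p) 𝓑 := by
  obtain ⟨𝓤, hU, hc⟩ := exists_mk_eq_character p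
  set κ := character p with hκ
  let I := κ.ord.ToType
  have e : I ≃ 𝓤 := (Cardinal.eq.1 (by simp [I, hc])).some
  obtain ⟨V, hV⟩ := exists_forall_of_wellFoundedLT (I := I)
    (Y := {V : Set X // IsOpen V ∧ p ∈ V})
    (fun i g y => y.1 ⊆ e i ∧ ∀ j hj, ¬ (g j hj).1 ⊆ y.1) (by
      intro i g
      let 𝓖 : Set (Set X) := Set.range fun j : Set.Iio i => (g j.1 j.2).1
      have hG : ¬ IsNbhdBase {p} 𝓖 := fun h => by
        have h1 := character_le h
        exact (h1.trans mk_range_le).not_gt (mk_Iio_ord_lt i)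
      have : ∃ W : Set X, IsOpen W ∧ p ∈ W ∧ ∀ U ∈ 𝓖, ¬ U ⊆ W := by
        by_contra! hcon
        refine hG ⟨?_, ?_, fun W hW hp => hcon W hW (hp rfl)⟩
        · rintro _ ⟨j, rfl⟩
          exact (g j.1 j.2).2.1
        · rintro _ ⟨j, rfl⟩
          exact Set.singleton_subset_iff.2 (g j.1 j.2).2.2
      obtain ⟨W, hW, hpW, hn⟩ := this
      refine ⟨⟨W ∩ e i, hW.inter (hU.isOpen _ (e i).2), hpW, hU.subset _ (e i).2 rfl⟩,
        Set.inter_subset_right, fun j hj hs => hn _ ⟨⟨j, hj⟩, rfl⟩ (hs.trans Set.inter_subset_left)⟩)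
  refine ⟨Set.range fun i => (V i).1, ⟨?_, ?_, ?_⟩, ?_⟩
  · rintro _ ⟨j, rfl⟩
    exact (V j).2.1
  · rintro _ ⟨j, rfl⟩
    exact Set.singleton_subset_iff.2 (V j).2.2
  · intro W hW hp
    obtain ⟨U, hUU, hUW⟩ := hU.exists_subset W hW hp
    refine ⟨_, ⟨e.symm ⟨U, hUU⟩, rfl⟩, ((hV _).1.trans ?_)⟩
    simpa using hUW
  · rintro ⟨_, i, rfl⟩ hle
    have := noMaxOrder h0
    obtain ⟨i', hi'⟩ := exists_gt i
    refine hle.not_gt (lt_of_le_of_lt ?_ (mk_Iio_ord_lt i'))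
    -- every member of the base that includes `V i` is `V j` for some `j ≤ i`
    refine le_trans (b := #{W : Set X | ∃ j < i', (V j).1 = W}) ?_ (mk_le_of_surjective
        (f := fun j : Set.Iio i' => (⟨_, j.1, j.2, rfl⟩ : {W : Set X | ∃ j < i', (V j).1 = W})) ?_)
    · refine mk_le_of_injective (f := fun q => ⟨q.1.1, ?_⟩) ?_
      · obtain ⟨⟨_, j, rfl⟩, hq⟩ := q
        refine ⟨j, ?_, rfl⟩
        by_contra! hj
        exact (hV j).2 i (hi'.trans_le hj) hq
      · intro q r hqr
        exact Subtype.ext (Subtype.ext (Subtype.mk.inj hqr))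
    · rintro ⟨_, j, hj, rfl⟩
      exact ⟨⟨j, hj⟩, rfl⟩

end Character

/-! ### Independent families from large π-character -/

section Independent

variable {X : Type u} [TopologicalSpace X] [CompactSpace X] [T2Space X]

/-- If all π-characters are at least `κ`, then fewer than `κ` nonempty open sets can be split
simultaneously, below one of them, by two open sets with disjoint closures. As the family `𝓐` is
not a local π-base anywhere, each point `q` has a neighborhood `W q` including no member of `𝓐`.
Finitely many smaller neighborhoods `N q` cover `X`, so below some member of `𝓐` one of them meets
every member; the sets to use are `N q` and the exterior of a neighborhood between `N q` and
`W q`. -/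
theorem exists_splitting_pair {κ : Cardinal.{u}} (hπ : ∀ q : X, κ ≤ piCharacter q)
    {𝓐 : Set (Set X)} (hA : #𝓐 < κ) (hne : ∀ A ∈ 𝓐, A.Nonempty) (ho : ∀ A ∈ 𝓐, IsOpen A)
    (h𝓐 : 𝓐.Nonempty) :
    ∃ A ∈ 𝓐, ∃ V : Bool → Set X, (∀ b, IsOpen (V b)) ∧
      Disjoint (closure (V true)) (closure (V false)) ∧
      ∀ A' ∈ 𝓐, A' ⊆ A → ∀ b, (A' ∩ V b).Nonempty := by
  have hW : ∀ q : X, ∃ W, IsOpen W ∧ q ∈ W ∧ ∀ A ∈ 𝓐, ¬ A ⊆ W := by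
    intro q
    by_contra! hcon
    exact ((hπ q).trans (piCharacter_le ⟨ho, hne, hcon⟩)).not_gt hA
  choose W hWo hWq hWA using hW
  have hN : ∀ q : X, ∃ O, IsOpen O ∧ q ∈ O ∧ closure O ⊆ W q := by
    intro q
    obtain ⟨O, hO, hqO, hOW⟩ := normal_exists_closure_subset isClosed_singleton (hWo q)
      (Set.singleton_subset_iff.2 (hWq q))
    exact ⟨O, hO, hqO rfl, hOW⟩
  choose O hOo hOq hOW using hN
  have hN : ∀ q : X, ∃ N, IsOpen N ∧ q ∈ N ∧ closure N ⊆ O q := by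
    intro q
    obtain ⟨N, hN, hqN, hNO⟩ := normal_exists_closure_subset isClosed_singleton (hOo q)
      (Set.singleton_subset_iff.2 (hOq q))
    exact ⟨N, hN, hqN rfl, hNO⟩
  choose N hNo hNq hNO using hN
  obtain ⟨D, hD⟩ := isCompact_univ.elim_finite_subcover N hNo
    (fun q _ => Set.mem_iUnion.2 ⟨q, hNq q⟩)
  have key : ∃ q ∈ D, ∃ A ∈ 𝓐, ∀ A' ∈ 𝓐, A' ⊆ A → (A' ∩ N q).Nonempty := by
    by_contra! hcon
    -- otherwise some member of `𝓐` misses all the sets of a finite cover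
    have : ∀ E : Finset X, E ⊆ D → ∃ A ∈ 𝓐, ∀ q ∈ E, A ∩ N q = ∅ := by
      classical
      intro E
      induction E using Finset.induction_on with
      | empty => intro _; exact ⟨_, h𝓐.some_mem, by simp⟩
      | insert q E hq ih =>
        intro hE
        obtain ⟨A, hA, hAE⟩ := ih fun x hx => hE (Finset.mem_insert_of_mem hx)
        obtain ⟨A', hA', hs, he⟩ := hcon q (hE (Finset.mem_insert_self _ _)) A hA
        refine ⟨A', hA', fun r hr => ?_⟩
        rcases Finset.mem_insert.1 hr with rfl | hr
        · exact he
        · exact Set.subset_empty_iff.1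
            ((Set.inter_subset_inter_left _ hs).trans (hAE r hr).subset)
    obtain ⟨A, hA, hAD⟩ := this D subset_rfl
    obtain ⟨x, hx⟩ := hne A hA
    obtain ⟨q, hq, hxq⟩ := Set.mem_iUnion₂.1 (hD (Set.mem_univ x))
    exact (hAD q hq).subset ⟨hx, hxq⟩
  obtain ⟨q, -, A, hA, hq⟩ := key
  refine ⟨A, hA, fun b => if b then N q else (closure (O q))ᶜ, ?_, ?_, ?_⟩
  · rintro (_ | _)
    · simp
    · simpa using hNo q
  · simp only [if_true, Bool.false_eq_true, if_false]
    rw [closure_compl]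
    exact Set.disjoint_compl_right_iff_subset.2
      ((hNO q).trans ((hOo q).subset_interior_closure))
  · rintro A' hA' hs (_ | _)
    · simp only [Bool.false_eq_true, if_false]
      by_contra hcon
      rw [Set.not_nonempty_iff_eq_empty, ← Set.disjoint_iff_inter_eq_empty,
        Set.disjoint_compl_right_iff_subset] at hcon
      exact hWA q A' hA' (hcon.trans (hOW q))
    · simpa using hq A' hA' hs

/-- Šapirovskiĭ's theorem for a regular uncountable cardinal `κ`: if all π-characters are at
least `κ`, there are `κ` many pairs of open sets with disjoint closures which are independent, i.e.
any choice of one set from each of finitely many pairs has a common point. -/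
theorem exists_independent_pairs {κ : Cardinal.{u}} (hκ : κ.IsRegular) (h0 : ℵ₀ < κ)
    [Nonempty X] (hπ : ∀ q : X, κ ≤ piCharacter q) :
    ∃ (J : Type u) (V : J → Bool → Set X), #J = κ ∧
      (∀ j, Disjoint (closure (V j true)) (closure (V j false))) ∧
      ∀ (ε : J → Bool) (D : Finset J), (⋂ j ∈ D, V j (ε j)).Nonempty := by
  let I := κ.ord.ToType
  -- `cell V s` is the set selected by the finite set `s` of choices `(i, b)` from the pairs `V i`
  let cell (V : I → Bool → Set X) (s : Finset (I × Bool)) : Set X := ⋂ x ∈ s, V x.1 x.2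
  -- Stage `i` yields a pair and a finite set of earlier choices such that both members of the pair
  -- meet every nonempty earlier cell included in the cell of that finite set.
  obtain ⟨f, hf⟩ := exists_forall_of_wellFoundedLT (I := I)
    (Y := {V : Bool → Set X // ∀ b, IsOpen (V b)} × Finset (I × Bool))
    (fun i g y => Disjoint (closure (y.1.1 true)) (closure (y.1.1 false)) ∧
      (∀ x ∈ y.2, x.1 < i) ∧
      (⋂ x ∈ y.2, ⋂ h : x.1 < i, (g x.1 h).1.1 x.2).Nonempty ∧
      ∀ s : Finset (I × Bool), (∀ x ∈ s, x.1 < i) →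
        (⋂ x ∈ s, ⋂ h : x.1 < i, (g x.1 h).1.1 x.2).Nonempty →
        (⋂ x ∈ s, ⋂ h : x.1 < i, (g x.1 h).1.1 x.2) ⊆
          (⋂ x ∈ y.2, ⋂ h : x.1 < i, (g x.1 h).1.1 x.2) →
        ∀ b, ((⋂ x ∈ s, ⋂ h : x.1 < i, (g x.1 h).1.1 x.2) ∩ y.1.1 b).Nonempty) (by
      intro i g
      let C (s : Finset (I × Bool)) : Set X := ⋂ x ∈ s, ⋂ h : x.1 < i, (g x.1 h).1.1 x.2
      let 𝓐 : Set (Set X) := {A | A.Nonempty ∧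
        ∃ s : {s : Finset (I × Bool) // ∀ x ∈ s, x.1 ∈ Set.Iio i}, C s.1 = A}
      have hA : #𝓐 < κ := (mk_le_mk_of_subset fun A hA => hA.2).trans_lt
        ((mk_range_le (f := fun s : {s : Finset (I × Bool) // ∀ x ∈ s, x.1 ∈ Set.Iio i} =>
          C s.1)).trans_lt (mk_finset_prod_bool_lt h0 (mk_Iio_ord_lt i)))
      obtain ⟨A, ⟨hne, ⟨t, ht⟩, rfl⟩, V, hV, hd, hs⟩ := exists_splitting_pair hπ hA
        (fun A h => h.1) (by
          rintro _ ⟨-, s, rfl⟩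
          exact isOpen_biInter_finset fun x _ => isOpen_iInter_of_finite fun h => (g x.1 h).1.2 _)
        ⟨Set.univ, Set.univ_nonempty, ⟨∅, by simp⟩, by simp [C]⟩
      exact ⟨⟨⟨V, hV⟩, t⟩, hd, ht, hne, fun s h1 h2 h3 => hs _ ⟨h2, ⟨s, h1⟩, rfl⟩ h3⟩)
  have hcell : ∀ i (s : Finset (I × Bool)), (∀ x ∈ s, x.1 < i) →
      (⋂ x ∈ s, ⋂ _ : x.1 < i, (f x.1).1.1 x.2) = cell (fun j => (f j).1.1) s := by
    intro i s hs
    refine Set.iInter₂_congr fun x hx => ?_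
    simp [hs x hx]
  -- The pairs of the `κ` many stages with the same finite set `t` are independent below its cell.
  obtain ⟨t, ht⟩ := exists_mk_fiber_of_regressive hκ h0 (fun i => (f i).2) fun i => (hf i).2.1
  refine ⟨{i // (f i).2 = t}, fun j => (f j.1).1.1, ht, fun j => (hf j.1).1, fun ε D => ?_⟩
  classical
  have hcell_t : (cell (fun j => (f j).1.1) t).Nonempty := by
    obtain ⟨i, hi⟩ : Nonempty {i // (f i).2 = t} := by
      rw [← mk_ne_zero_iff, ht]; exact hκ.ne_zero
    have := (hf i).2.2.1
    rwa [hcell i _ (hf i).2.1, hi] at this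
  suffices h : (cell (fun j => (f j).1.1) (t ∪ D.image fun j => (j.1, ε j))).Nonempty by
    refine h.mono fun x hx => ?_
    simp only [Set.mem_iInter, cell] at hx ⊢
    intro j hj
    exact hx (j.1, ε j) (Finset.mem_union_right _ (Finset.mem_image_of_mem _ hj))
  induction D using Finset.induction_on_max with
  | empty => simpa using hcell_t
  | insert i s his ih =>
    have hlt : ∀ x ∈ t ∪ s.image fun j => (j.1, ε j), x.1 < i.1 := by
      intro x hx
      rcases Finset.mem_union.1 hx with hx | hx
      · exact (hf i.1).2.1 x (by rwa [i.2])
      · obtain ⟨j, hj, rfl⟩ := Finset.mem_image.1 hx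
        exact his j hj
    have h := (hf i.1).2.2.2 (t ∪ s.image fun j => (j.1, ε j)) hlt
    rw [hcell _ _ hlt, hcell _ _ (hf i.1).2.1, i.2] at h
    refine (h ih ?_ (ε i)).mono ?_
    · exact Set.biInter_subset_biInter_left fun x hx => Finset.mem_union_left _ hx
    · rintro x ⟨hx, hxi⟩
      simp only [Set.mem_iInter, cell] at hx ⊢
      intro y hy
      rw [Finset.image_insert, Finset.union_insert] at hy
      rcases Finset.mem_insert.1 hy with rfl | hy
      · exact hxi
      · exact hx y hy

end Independent

/-! ### Point-finite neighborhood families and `ℵ₀^op`-like local bases -/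

section PointFinite

variable {X : Type u} [TopologicalSpace X]

/-- `p` has a `J`-indexed family of open neighborhoods such that no neighborhood of `p` is included
in infinitely many of them. -/
def HasPointFiniteNbhds (p : X) (J : Type u) : Prop :=
  ∃ N : J → Set X, (∀ j, IsOpen (N j) ∧ p ∈ N j) ∧
    ∀ O, IsOpen O → p ∈ O → {j | O ⊆ N j}.Finite

/-- An independent family of pairs of disjoint closed sets, indexed by `J`, yields a point with a
point-finite `J`-indexed family of neighborhoods. The point is taken in a minimal closed set `F`
that meets all the sets `⋂ j, C j (ε j)`; at each index the neighborhood is the complement of a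
member of the pair. If a neighborhood `O` of the point were included in infinitely many of them,
then by compactness `F \ O` would still meet all the sets `⋂ j, C j (ε j)`. -/
theorem exists_hasPointFiniteNbhds_of_independent [CompactSpace X] [Nonempty X] {J : Type u}
    (C : J → Bool → Set X) (hC : ∀ j b, IsClosed (C j b)) (hd : ∀ j, Disjoint (C j true) (C j false))
    (hind : ∀ (ε : J → Bool) (D : Finset J), (⋂ j ∈ D, C j (ε j)).Nonempty) :
    ∃ p : X, HasPointFiniteNbhds p J := by
  classical
  let S : Set (Set X) := {F | IsClosed F ∧ ∀ ε : J → Bool, (F ∩ ⋂ j, C j (ε j)).Nonempty}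
  have hK : ∀ ε : J → Bool, IsClosed (⋂ j, C j (ε j)) := fun ε => isClosed_iInter fun j => hC j _
  have huniv : Set.univ ∈ S := by
    refine ⟨isClosed_univ, fun ε => ?_⟩
    refine isCompact_univ.inter_iInter_nonempty _ (fun j => hC j _) fun D => ?_
    simpa using hind ε D
  obtain ⟨F, hF⟩ : ∃ F, Minimal (· ∈ S) F := by
    refine zorn_superset S fun c hc hchain => ?_
    rcases c.eq_empty_or_nonempty with rfl | hne
    · exact ⟨_, huniv, by simp⟩
    refine ⟨⋂₀ c, ⟨isClosed_sInter fun s hs => (hc hs).1, fun ε => ?_⟩,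
      fun s hs => Set.sInter_subset_of_mem hs⟩
    have : Nonempty c := hne.to_subtype
    have h := IsCompact.nonempty_iInter_of_directed_nonempty_isCompact_isClosed
      (fun s : c => s.1 ∩ ⋂ j, C j (ε j)) ?_ (fun s => (hc s.2).2 ε)
      (fun s => ((hc s.2).1.inter (hK ε)).isCompact) (fun s => (hc s.2).1.inter (hK ε))
    · rwa [← Set.iInter_inter, ← Set.sInter_eq_iInter] at h
    · intro s t
      rcases hchain.total s.2 t.2 with h | h
      · exact ⟨s, subset_rfl, Set.inter_subset_inter_left _ h⟩
      · exact ⟨t, Set.inter_subset_inter_left _ h, subset_rfl⟩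
  obtain ⟨p, hp, -⟩ := hF.prop.2 fun _ => true
  have hb : ∀ j, ∃ b, p ∉ C j b := by
    intro j
    by_contra! h
    exact Set.disjoint_left.1 (hd j) (h true) (h false)
  choose b hb using hb
  refine ⟨p, fun j => (C j (b j))ᶜ, fun j => ⟨(hC j _).isOpen_compl, hb j⟩, fun O hO hpO => ?_⟩
  by_contra hinf
  -- minimality of `F` gives finitely many choices `ε` on `D` which cannot be realized in `F \ O`
  have hFO : F \ O ∉ S := fun h => (hF.le_of_le h Set.sdiff_subset hp).2 hpO
  have hFOc : IsClosed (F \ O) := hF.prop.1.sdiff hO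
  simp only [S, Set.mem_ofPred_eq, not_and, not_forall] at hFO
  obtain ⟨ε, hε⟩ := hFO hFOc
  obtain ⟨D, hD⟩ : ∃ D : Finset J, ¬ (F \ O ∩ ⋂ j ∈ D, C j (ε j)).Nonempty := by
    by_contra! h
    exact hε (hFOc.isCompact.inter_iInter_nonempty _ (fun j => hC j _) h)
  obtain ⟨j, hj, hjD⟩ := (show {j | O ⊆ (C j (b j))ᶜ}.Infinite from hinf).exists_notMem_finset D
  -- changing the choice at `j ∉ D` to the one that avoids `O` leads to a point outside `O`
  obtain ⟨x, hxF, hx⟩ := hF.prop.2 (Function.update ε j (b j))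
  rw [Set.mem_iInter] at hx
  refine hD ⟨x, ⟨hxF, fun hxO => hj hxO (by simpa using hx j)⟩, Set.mem_iInter₂.2 fun i hi => ?_⟩
  have := hx i
  rwa [Function.update_of_ne (by rintro rfl; exact hjD hi)] at this

theorem HasPointFiniteNbhds.of_injective {p : X} {J K : Type u} (h : HasPointFiniteNbhds p J)
    {f : K → J} (hf : Function.Injective f) : HasPointFiniteNbhds p K := by
  obtain ⟨N, hN, hfin⟩ := h
  exact ⟨N ∘ f, fun k => hN _, fun O hO hp => (hfin O hO hp).preimage hf.injOn⟩

theorem HasPointFiniteNbhds.of_mk_le {p : X} {J K : Type u} (h : HasPointFiniteNbhds p J)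
    (hK : #K ≤ #J) : HasPointFiniteNbhds p K :=
  h.of_injective (Cardinal.le_def K J |>.1 hK).some.injective

theorem HasPointFiniteNbhds.map {p : X} {J : Type u} (h : HasPointFiniteNbhds p J) (e : X ≃ₜ X) :
    HasPointFiniteNbhds (e p) J := by
  obtain ⟨N, hN, hfin⟩ := h
  refine ⟨fun j => e.symm ⁻¹' N j, fun j => ⟨(hN j).1.preimage e.symm.continuous, by
    simpa using (hN j).2⟩, fun O hO hp => ?_⟩
  refine (hfin (e ⁻¹' O) (hO.preimage e.continuous) hp).subset fun j hj x hx => ?_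
  simpa using hj hx

/-- Point-finite families on the pieces of a partition combine with one on the index set of the
partition. -/
theorem HasPointFiniteNbhds.combine {p : X} {I M : Type u} (m : I → M)
    (hM : HasPointFiniteNbhds p M) (h : ∀ k, HasPointFiniteNbhds p {i // m i = k}) :
    HasPointFiniteNbhds p I := by
  obtain ⟨E, hE, hEfin⟩ := hM
  choose N hN hNfin using h
  refine ⟨fun i => E (m i) ∩ N (m i) ⟨i, rfl⟩, fun i =>
    ⟨(hE _).1.inter (hN _ _).1, (hE _).2, (hN _ _).2⟩, fun O hO hp => ?_⟩
  refine ((hEfin O hO hp).biUnion fun k _ =>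
    (hNfin k O hO hp).image Subtype.val).subset fun i hi => ?_
  simp only [Set.mem_ofPred_eq, Set.subset_inter_iff] at hi
  exact Set.mem_iUnion₂.2 ⟨m i, hi.1, ⟨i, rfl⟩, hi.2, rfl⟩

theorem exists_hasPointFiniteNbhds_of_isRegular [CompactSpace X] [T2Space X] [Nonempty X]
    {κ : Cardinal.{u}} (hκ : κ.IsRegular) (h0 : ℵ₀ < κ) (hπ : ∀ q : X, κ ≤ piCharacter q) :
    ∃ (p : X) (J : Type u), #J = κ ∧ HasPointFiniteNbhds p J := by
  obtain ⟨J, V, hJ, hd, hind⟩ := exists_independent_pairs hκ h0 hπ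
  obtain ⟨p, hp⟩ := exists_hasPointFiniteNbhds_of_independent (fun j b => closure (V j b))
    (fun _ _ => isClosed_closure) hd
    (fun ε D => (hind ε D).mono (Set.iInter₂_mono fun _ _ => subset_closure))
  exact ⟨p, J, hJ, hp⟩

/-- In a homogeneous compactum all of whose π-characters are at least the uncountable cardinal
`κ`, each point has a point-finite family of `κ` many neighborhoods. For singular `κ`, the families
obtained for smaller regular cardinals live, by homogeneity, at one and the same point, where they
are combined along a cofinal set. -/
theorem IsHomogeneous.hasPointFiniteNbhds [CompactSpace X] [T2Space X] (hX : IsHomogeneous X)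
    {κ : Cardinal.{u}} (h0 : ℵ₀ < κ) (hπ : ∀ q : X, κ ≤ piCharacter q) (p : X)
    {J : Type u} (hJ : #J = κ) : HasPointFiniteNbhds p J := by
  have : Nonempty X := ⟨p⟩
  have hreg : ∀ μ : Cardinal.{u}, μ.IsRegular → ℵ₀ < μ → μ ≤ κ → ∀ K : Type u, #K ≤ μ →
      HasPointFiniteNbhds p K := by
    intro μ hμ h1 h2 K hK
    obtain ⟨q, J', hJ', hq⟩ := exists_hasPointFiniteNbhds_of_isRegular hμ h1
      fun q => h2.trans (hπ q)
    obtain ⟨e, rfl⟩ := hX q p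
    exact (hq.map e).of_mk_le (hK.trans_eq hJ'.symm)
  rcases isRegular_or_isSingular h0.le with hr | hs
  · exact hreg κ hr h0 le_rfl J hJ.le
  have hsmall : ∀ K : Type u, #K < κ → HasPointFiniteNbhds p K := by
    intro K hK
    refine hreg (Order.succ (max ℵ₀ #K)) (isRegular_succ (le_max_left _ _))
      (Order.lt_succ_of_le (le_max_left _ _)) (Order.succ_le_of_lt (max_lt h0 hK)) K
      ((le_max_right _ _).trans (Order.le_succ _))
  obtain ⟨s, hs1, hs2⟩ := Order.exists_cof_eq κ.ord.ToType
  rw [Ordinal.cof_toType] at hs2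
  choose m hm1 hm2 using hs1
  refine HasPointFiniteNbhds.of_mk_le (J := κ.ord.ToType) ?_ (by simp [hJ])
  have := noMaxOrder h0.le
  refine HasPointFiniteNbhds.combine (M := s) (fun i => ⟨m i, hm1 i⟩)
    (hsmall _ (hs2 ▸ hs.cof_ord_lt)) fun k => hsmall _ ?_
  obtain ⟨k', hk'⟩ := exists_gt k.1
  refine (mk_le_mk_of_subset (s := {i | (⟨m i, hm1 i⟩ : s) = k}) (t := Set.Iio k') ?_).trans_lt
    (mk_Iio_ord_lt k')
  rintro i rfl
  exact (hm2 i).trans_lt hk'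

/-- A local base indexed by itself through a point-finite family of neighborhoods can be shrunk to
an `ℵ₀^op`-like local base. -/
theorem HasPointFiniteNbhds.exists_isOpLike {p : X} {𝓤 : Set (Set X)} (hU : IsNbhdBase {p} 𝓤)
    (h : HasPointFiniteNbhds p 𝓤) :
    ∃ 𝓑 : Set (Set X), IsNbhdBase {p} 𝓑 ∧ IsOpLike ℵ₀ 𝓑 := by
  obtain ⟨N, hN, hfin⟩ := h
  have ho : ∀ U : 𝓤, IsOpen (U.1 ∩ N U) := fun U => (hU.isOpen _ U.2).inter (hN U).1
  have hp : ∀ U : 𝓤, p ∈ U.1 ∩ N U := fun U => ⟨hU.subset _ U.2 rfl, (hN U).2⟩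
  refine ⟨Set.range fun U : 𝓤 => U.1 ∩ N U, ⟨?_, ?_, ?_⟩, ?_⟩
  · rintro _ ⟨U, rfl⟩
    exact ho U
  · rintro _ ⟨U, rfl⟩
    exact Set.singleton_subset_iff.2 (hp U)
  · intro V hV hpV
    obtain ⟨U, hUU, hUV⟩ := hU.exists_subset V hV hpV
    exact ⟨_, ⟨⟨U, hUU⟩, rfl⟩, Set.inter_subset_left.trans hUV⟩
  · rintro ⟨_, U, rfl⟩ hle
    refine hle.not_gt ?_
    rw [lt_aleph0_iff_finite]
    have hfin' := (hfin _ (ho U) (hp U)).image fun W : 𝓤 => W.1 ∩ N W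
    refine Set.Finite.to_subtype (Set.Finite.of_finite_image (hfin'.subset ?_)
      Subtype.val_injective.injOn)
    rintro _ ⟨⟨_, W, rfl⟩, hW, rfl⟩
    exact ⟨W, Set.Subset.trans hW Set.inter_subset_right, rfl⟩

end PointFinite

/-! ### The cardinality of a homogeneous compactum -/

section CardinalityBound

variable {X : Type u} [TopologicalSpace X]

theorem IsCellularFamily.mk_le_cellularity {𝓒 : Set (Set X)} (h : IsCellularFamily 𝓒) :
    #𝓒 ≤ cellularity X :=
  (le_ciSup (f := fun 𝓒 : {𝓒 : Set (Set X) // IsCellularFamily 𝓒} => #(𝓒 : Set (Set X)))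
    bddAbove_of_small ⟨𝓒, h⟩).trans (le_max_right _ _)

/-- Any family of open sets has a subfamily of at most `c(X)` members whose union is dense in the
union of the whole family. -/
theorem exists_dense_subfamily {J : Type u} (O : J → Set X) (hO : ∀ j, IsOpen (O j)) :
    ∃ T : Set J, #T ≤ cellularity X ∧ ∀ j, O j ⊆ closure (⋃ i ∈ T, O i) := by
  obtain ⟨𝓒, h𝓒⟩ := zorn_subset {𝓒 : Set (Set X) | IsCellularFamily 𝓒 ∧ ∀ C ∈ 𝓒, ∃ j, C ⊆ O j} (by
    intro c hc hchain
    refine ⟨⋃₀ c, ⟨⟨?_, ?_, ?_⟩, ?_⟩, fun s hs => Set.subset_sUnion_of_mem hs⟩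
    · rintro U ⟨s, hs, hU⟩
      exact (hc hs).1.isOpen U hU
    · rintro U ⟨s, hs, hU⟩
      exact (hc hs).1.nonempty U hU
    · exact (Set.pairwise_sUnion hchain.directedOn).2 fun s hs => (hc hs).1.pairwiseDisjoint
    · rintro U ⟨s, hs, hU⟩
      exact (hc hs).2 U hU)
  obtain ⟨hcell, hsub⟩ := h𝓒.prop
  choose f hf using fun C : 𝓒 => hsub C.1 C.2
  refine ⟨Set.range f, mk_range_le.trans hcell.mk_le_cellularity, fun j x hx => ?_⟩
  by_contra hcon
  let G : Set X := O j ∩ (closure (⋃ i ∈ Set.range f, O i))ᶜ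
  have hdisj : ∀ C ∈ 𝓒, Disjoint G C := by
    intro C hC
    refine Set.disjoint_left.2 fun y hy hyC => hy.2 (subset_closure ?_)
    exact Set.mem_iUnion₂.2 ⟨f ⟨C, hC⟩, ⟨_, rfl⟩, hf ⟨C, hC⟩ hyC⟩
  have hmem : insert G 𝓒 ∈ {𝓒 : Set (Set X) | IsCellularFamily 𝓒 ∧ ∀ C ∈ 𝓒, ∃ j, C ⊆ O j} := by
    refine ⟨⟨?_, ?_, ?_⟩, ?_⟩
    · rintro U (rfl | hU)
      · exact (hO j).inter isClosed_closure.isOpen_compl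
      · exact hcell.isOpen U hU
    · rintro U (rfl | hU)
      · exact ⟨x, hx, hcon⟩
      · exact hcell.nonempty U hU
    · exact hcell.pairwiseDisjoint.insert fun C hC _ =>
        ⟨hdisj C hC, (hdisj C hC).symm⟩
    · rintro U (rfl | hU)
      · exact ⟨j, Set.inter_subset_left⟩
      · exact hsub U hU
  have hG : G ∈ 𝓒 := h𝓒.le_of_ge hmem (Set.subset_insert _ _) (Set.mem_insert _ _)
  exact Set.disjoint_left.1 (hdisj G hG) ⟨hx, hcon⟩ ⟨hx, hcon⟩

theorem exists_dense_indexed_subfamily {J M : Type u} [Nonempty J] (hM : cellularity X ≤ #M)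
    (O : J → Set X) (hO : ∀ j, IsOpen (O j)) :
    ∃ e : M → J, ∀ j, O j ⊆ closure (⋃ m, O (e m)) := by
  obtain ⟨T, hT, hd⟩ := exists_dense_subfamily O hO
  obtain ⟨g⟩ := Cardinal.le_def T M |>.1 (hT.trans hM)
  refine ⟨Function.extend g Subtype.val fun _ => Classical.arbitrary J, fun j =>
    (hd j).trans (closure_mono ?_)⟩
  refine Set.iUnion₂_subset fun i hi => ?_
  refine Set.subset_iUnion_of_subset (g ⟨i, hi⟩) ?_
  rw [g.injective.extend_apply]

/-- A set of size at most `2 ^ μ` containing a given point and closed under an operation with `μ`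
many arguments, obtained by iterating the operation through `μ⁺` stages. -/
theorem exists_closed_under {X M : Type u} [Infinite M] (G : (M → X × M) → X) (x₀ : X) :
    ∃ A : Set X, x₀ ∈ A ∧ #A ≤ 2 ^ #M ∧ ∀ e : M → X × M, (∀ m, (e m).1 ∈ A) → G e ∈ A := by
  have hM : ℵ₀ ≤ #M := aleph0_le_mk M
  have h2 : ℵ₀ ≤ 2 ^ #M := hM.trans (cantor _).le
  have hreg := isRegular_succ hM
  let I := (Order.succ #M).ord.ToType
  obtain ⟨A, hA⟩ := exists_forall_of_wellFoundedLT (I := I) (Y := Set X)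
    (fun i g y => y = insert x₀ (G '' {e | ∀ m, (e m).1 ∈ ⋃ j : Set.Iio i, g j.1 j.2}))
    (fun i g => ⟨_, rfl⟩)
  have hcard : ∀ i, #(A i) ≤ 2 ^ #M := by
    intro i
    induction i using WellFoundedLT.induction with
    | ind i ih =>
      have hU : #(⋃ j : Set.Iio i, A j.1) ≤ 2 ^ #M := by
        refine (mk_iUnion_le _).trans (mul_le_of_le h2 ?_ (ciSup_le' fun j => ih j.1 j.2))
        exact (Order.lt_succ_iff.1 (mk_Iio_ord_lt i)).trans (cantor _).le
      rw [hA i]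
      refine (mk_insert_le).trans ?_
      refine add_le_of_le h2 (mk_image_le.trans ?_) (one_le_aleph0.trans h2)
      have : #{e : M → X × M | ∀ m, (e m).1 ∈ ⋃ j : Set.Iio i, A j.1} ≤
          #(M → (⋃ j : Set.Iio i, A j.1 : Set X) × M) := by
        refine mk_le_of_injective (f := fun e m => (⟨(e.1 m).1, e.2 m⟩, (e.1 m).2)) ?_
        intro e e' h
        refine Subtype.ext (funext fun m => ?_)
        have := congrFun h m
        simp only [Prod.mk.injEq, Subtype.mk.injEq] at this
        exact Prod.ext this.1 this.2
      refine this.trans ?_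
      rw [← power_def, mk_prod, lift_id, lift_id]
      refine (power_le_power_right (mul_le_of_le h2 hU (cantor _).le)).trans_eq ?_
      rw [← power_mul, mul_eq_self hM]
  refine ⟨⋃ i, A i, ?_, ?_, ?_⟩
  · obtain ⟨i, -⟩ := exists_forall_lt_of_mk_lt hreg (S := ∅) (by simp)
    exact Set.mem_iUnion.2 ⟨i, by rw [hA]; exact Set.mem_insert _ _⟩
  · refine (mk_iUnion_le _).trans (mul_le_of_le h2 ?_ (ciSup_le' hcard))
    simpa [I] using Order.succ_le_of_lt (cantor #M)
  · intro e he
    choose i hi using fun m => Set.mem_iUnion.1 (he m)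
    obtain ⟨b, hb⟩ := exists_forall_range_lt hreg (Order.lt_succ _) i
    refine Set.mem_iUnion.2 ⟨b, ?_⟩
    rw [hA]
    exact Set.mem_insert_of_mem _ ⟨e, fun m => Set.mem_iUnion.2 ⟨⟨i m, hb m⟩, hi m⟩, rfl⟩

/-- The bound `d(X) ≤ 2 ^ μ` for a compactum with cellularity and all π-characters at most `μ`.
A set closed under picking points outside closures of unions of `μ` many members of the local
π-bases of its points is dense. -/
theorem exists_dense_mk_le [CompactSpace X] [T2Space X] [Nonempty X] {M : Type u} [Infinite M]
    (hc : cellularity X ≤ #M) (B : X → M → Set X) (hB : ∀ x, IsLocalPiBase x (Set.range (B x))) :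
    ∃ A : Set X, Dense A ∧ #A ≤ 2 ^ #M := by
  have hG : ∀ e : M → X × M, ∃ y, closure (⋃ m, B (e m).1 (e m).2) ≠ Set.univ →
      y ∉ closure (⋃ m, B (e m).1 (e m).2) := by
    intro e
    by_cases h : closure (⋃ m, B (e m).1 (e m).2) = Set.univ
    · exact ⟨Classical.arbitrary X, fun h' => absurd h h'⟩
    · obtain ⟨y, hy⟩ := (Set.ne_univ_iff_exists_notMem _).1 h
      exact ⟨y, fun _ => hy⟩
  choose G hG using hG
  obtain ⟨A, h0, hA, hcl⟩ := exists_closed_under G (Classical.arbitrary X)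
  refine ⟨A, ?_, hA⟩
  by_contra hnd
  obtain ⟨z, hz⟩ : ∃ z, z ∉ closure A := by
    by_contra! h
    exact hnd h
  obtain ⟨V, hV, hzV, hVA⟩ := normal_exists_closure_subset isClosed_singleton
    isClosed_closure.isOpen_compl (Set.singleton_subset_iff.2 hz)
  let J := {y : X × M // y.1 ∈ A ∧ Disjoint (B y.1 y.2) V}
  have hJ : ∀ x ∈ A, ∀ O, IsOpen O → x ∈ O → ∃ j : J, B j.1.1 j.1.2 ⊆ O := by
    intro x hx O hO hxO
    obtain ⟨_, ⟨m, rfl⟩, hm⟩ := (hB x).exists_subset (O ∩ (closure V)ᶜ)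
      (hO.inter isClosed_closure.isOpen_compl) ⟨hxO, fun h => hVA h (subset_closure hx)⟩
    refine ⟨⟨(x, m), hx, ?_⟩, hm.trans Set.inter_subset_left⟩
    exact Set.disjoint_left.2 fun y hy hyV => (hm hy).2 (subset_closure hyV)
  obtain ⟨j0, -⟩ := hJ _ h0 Set.univ isOpen_univ trivial
  have : Nonempty J := ⟨j0⟩
  obtain ⟨e, he⟩ := exists_dense_indexed_subfamily hc (fun j : J => B j.1.1 j.1.2)
    fun j => (hB j.1.1).isOpen _ ⟨_, rfl⟩
  -- `A` lies in the closure of this union, whereas the union misses `V`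
  have hne : closure (⋃ m, B (e m).1.1 (e m).1.2) ≠ Set.univ := by
    intro h
    have hd : Disjoint (closure (⋃ m, B (e m).1.1 (e m).1.2)) V :=
      (Set.disjoint_iUnion_left.2 fun m => (e m).2.2).closure_left hV
    exact Set.disjoint_left.1 hd (h ▸ Set.mem_univ z) (hzV rfl)
  have hGA := hcl (fun m => (e m).1) fun m => (e m).2.1
  refine hG (fun m => (e m).1) hne ?_
  rw [← closure_closure, mem_closure_iff]
  intro O hO hGO
  obtain ⟨j, hj⟩ := hJ _ hGA O hO hGO
  obtain ⟨y, hy⟩ := (hB j.1.1).nonempty _ ⟨j.1.2, rfl⟩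
  exact ⟨y, hj hy, he j hy⟩

theorem exists_indexed_localPiBase {M : Type u} {p : X} (h : piCharacter p ≤ #M) :
    ∃ B : M → Set X, IsLocalPiBase p (Set.range B) := by
  obtain ⟨𝓑, hB, hc⟩ := exists_mk_eq_piCharacter p
  obtain ⟨g⟩ := Cardinal.le_def 𝓑 M |>.1 (hc.trans_le h)
  obtain ⟨U, hU, -⟩ := hB.exists_subset Set.univ isOpen_univ trivial
  have : Nonempty 𝓑 := ⟨⟨U, hU⟩⟩
  refine ⟨fun m => (Function.invFun g m).1, ⟨?_, ?_, fun V hV hp => ?_⟩⟩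
  · rintro _ ⟨m, rfl⟩
    exact hB.isOpen _ (Subtype.prop _)
  · rintro _ ⟨m, rfl⟩
    exact hB.nonempty _ (Subtype.prop _)
  · obtain ⟨W, hW, hWV⟩ := hB.exists_subset V hV hp
    refine ⟨_, ⟨g ⟨W, hW⟩, rfl⟩, ?_⟩
    simpa only [Function.leftInverse_invFun g.injective _] using hWV

/-- A homogeneous compactum with cellularity and π-character at most `μ` has at most `2 ^ μ`
points. Moving a local π-base of a fixed point `p` to `q` by a homeomorphism and choosing, inside
each of the resulting sets, a member of a global π-base of size `2 ^ μ` gives a code for `q` with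
`μ` many entries; as distinct points have disjoint neighborhoods, they have distinct codes. -/
theorem IsHomogeneous.mk_le [CompactSpace X] [T2Space X] (hX : IsHomogeneous X)
    {M : Type u} [Infinite M] (hc : cellularity X ≤ #M) (hπ : ∀ x : X, piCharacter x ≤ #M) :
    #X ≤ 2 ^ #M := by
  rcases isEmpty_or_nonempty X with hE | hE
  · simp
  have hM : ℵ₀ ≤ #M := aleph0_le_mk M
  have h2 : ℵ₀ ≤ 2 ^ #M := hM.trans (cantor _).le
  choose B hB using fun x => exists_indexed_localPiBase (hπ x)
  obtain ⟨A, hd, hA⟩ := exists_dense_mk_le hc B hB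
  let p := Classical.arbitrary X
  choose h hh using fun q => hX p q
  have hcode : ∀ q m, ∃ y : A × M, B y.1 y.2 ⊆ h q '' B p m := by
    intro q m
    have ho : IsOpen (h q '' B p m) := (h q).isOpenMap _ ((hB p).isOpen _ ⟨m, rfl⟩)
    obtain ⟨a, ha, haA⟩ := hd.inter_open_nonempty _ ho (((hB p).nonempty _ ⟨m, rfl⟩).image _)
    obtain ⟨_, ⟨k, rfl⟩, hk⟩ := (hB a).exists_subset _ ho ha
    exact ⟨(⟨a, haA⟩, k), hk⟩
  choose code hcode using hcode
  have hinj : Function.Injective code := by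
    intro q r hqr
    by_contra hne
    obtain ⟨V, W, hV, hW, hqV, hrW, hVW⟩ := t2_separation hne
    obtain ⟨_, ⟨m, rfl⟩, hm⟩ := (hB p).exists_subset (h q ⁻¹' V ∩ h r ⁻¹' W)
      ((hV.preimage (h q).continuous).inter (hW.preimage (h r).continuous))
      ⟨by simpa [hh] using hqV, by simpa [hh] using hrW⟩
    obtain ⟨y, hy⟩ := (hB (code q m).1).nonempty _ ⟨(code q m).2, rfl⟩
    have h1 := hcode q m hy
    have h2 := hcode r m (hqr ▸ hy)
    exact Set.disjoint_left.1 hVW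
      (Set.image_subset_iff.2 (fun z hz => (hm hz).1) h1)
      (Set.image_subset_iff.2 (fun z hz => (hm hz).2) h2)
  refine (mk_le_of_injective hinj).trans ?_
  rw [← power_def, mk_prod, lift_id, lift_id]
  refine (power_le_power_right (mul_le_of_le h2 hA (cantor _).le)).trans_eq ?_
  rw [← power_mul, mul_eq_self hM]

end CardinalityBound

/-! ### Points of small character in small compacta -/

section SmallCharacter

variable {X : Type u} [TopologicalSpace X] [CompactSpace X]

/-- In a compact space, a point which is the only common zero of `μ` many continuous functions has
character at most `μ`. -/
theorem character_le_of_common_zero {J : Type u} {μ : Cardinal.{u}} (hμ : ℵ₀ ≤ μ) (hJ : #J ≤ μ)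
    (f : J → C(X, ℝ)) {p : X} (hp : ∀ j, f j p = 0) (huniq : ∀ y, (∀ j, f j y = 0) → y = p) :
    character p ≤ μ := by
  let U (s : Finset J × ℕ) : Set X := ⋂ j ∈ s.1, {y | |f j y| < 1 / ((s.2 : ℝ) + 1)}
  have hbase : IsNbhdBase {p} (Set.range U) := by
    refine ⟨?_, ?_, fun V hV hpV => ?_⟩
    · rintro _ ⟨s, rfl⟩
      exact isOpen_biInter_finset fun j _ =>
        isOpen_lt (continuous_abs.comp (f j).continuous) continuous_const
    · rintro _ ⟨s, rfl⟩
      refine Set.singleton_subset_iff.2 (Set.mem_iInter₂.2 fun j _ => ?_)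
      simp only [Set.mem_ofPred_eq, hp, abs_zero]
      positivity
    · by_contra! hcon
      have hne : (Vᶜ ∩ ⋂ s : J × ℕ, {y | |f s.1 y| ≤ 1 / ((s.2 : ℝ) + 1)}).Nonempty := by
        refine hV.isClosed_compl.isCompact.inter_iInter_nonempty _ (fun s =>
          isClosed_le (continuous_abs.comp (f s.1).continuous) continuous_const) fun D => ?_
        classical
        obtain ⟨y, hy, hyV⟩ := Set.not_subset.1 (hcon _ ⟨(D.image Prod.fst, D.sup Prod.snd), rfl⟩)
        refine ⟨y, hyV, Set.mem_iInter₂.2 fun s hs => ?_⟩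
        have h1 : |f s.1 y| < _ := Set.mem_iInter₂.1 hy s.1 (Finset.mem_image_of_mem _ hs)
        refine (le_of_lt h1).trans (one_div_le_one_div_of_le (by positivity) ?_)
        have : s.2 ≤ D.sup Prod.snd := Finset.le_sup (f := Prod.snd) hs
        exact_mod_cast Nat.succ_le_succ this
      obtain ⟨y, hyV, hy⟩ := hne
      refine hyV (huniq y (fun j => ?_) ▸ hpV rfl)
      rw [Set.mem_iInter] at hy
      by_contra hj
      obtain ⟨n, hn⟩ := exists_nat_one_div_lt (abs_pos.2 hj)
      exact (hy (j, n)).not_gt hn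
  refine (character_le hbase).trans (mk_range_le.trans ?_)
  rw [mk_prod, lift_uzero, mk_nat, lift_aleph0]
  refine mul_le_of_le hμ ?_ hμ
  cases fintypeOrInfinite J
  · exact (lt_aleph0_of_finite _).le.trans hμ
  · rwa [mk_finset_of_infinite]

/-- A compactum with at most `μ⁺` points has a point of character at most `μ`. Otherwise, running
through all points `x i`, `i < μ⁺`, one finds continuous functions `f i` with `f i (x i) = 1` such
that any `μ` many of them have a common zero; by compactness all of them have one. -/
theorem exists_character_le [T2Space X] [Nonempty X] {μ : Cardinal.{u}} (hμ : ℵ₀ ≤ μ)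
    (hX : #X ≤ Order.succ μ) : ∃ p : X, character p ≤ μ := by
  by_contra! hchar
  let I := (Order.succ μ).ord.ToType
  obtain ⟨x, hx⟩ : ∃ x : I → X, Function.Surjective x := by
    obtain ⟨g⟩ := Cardinal.le_def X I |>.1 (by simpa [I] using hX)
    exact ⟨_, Function.invFun_surjective g.injective⟩
  obtain ⟨f, hf⟩ := exists_forall_of_wellFoundedLT (I := I) (Y := C(X, ℝ))
    (fun i g F => (∃ y, y ≠ x i ∧ ∀ j hj, g j hj y = 0) →
      F (x i) = 1 ∧ ∃ y, F y = 0 ∧ ∀ j hj, g j hj y = 0) (by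
      intro i g
      by_cases h : ∃ y, y ≠ x i ∧ ∀ j hj, g j hj y = 0
      · obtain ⟨y, hy, hg⟩ := h
        obtain ⟨F, h0, h1, -⟩ := exists_continuous_zero_one_of_isClosed (isClosed_singleton (x := y))
          (isClosed_singleton (x := x i)) (by simpa using hy)
        exact ⟨F, fun _ => ⟨h1 rfl, y, h0 rfl, hg⟩⟩
      · exact ⟨0, fun h' => absurd h' h⟩)
  let Z (i : I) : Set X := ⋂ j : Set.Iic i, {y | f j.1 y = 0}
  have hZc : ∀ i, IsClosed (Z i) := fun i =>
    isClosed_iInter fun j => isClosed_eq (f j.1).continuous continuous_const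
  have hmono : ∀ {i j}, i ≤ j → Z j ⊆ Z i := by
    intro i j hij y hy
    rw [Set.mem_iInter] at hy ⊢
    exact fun k => hy ⟨k.1, k.2.trans hij⟩
  have hdir : ∀ (S : Set I), Directed (· ⊇ ·) fun i : S => Z i.1 := by
    intro S i j
    rcases le_total i j with h | h
    · exact ⟨j, hmono h, subset_rfl⟩
    · exact ⟨i, subset_rfl, hmono h⟩
  have hinter : ∀ S : Set I, (∀ i ∈ S, (Z i).Nonempty) → ∃ y, ∀ i ∈ S, f i y = 0 := by
    intro S hS
    rcases S.eq_empty_or_nonempty with rfl | hne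
    · exact ⟨Classical.arbitrary X, by simp⟩
    have := hne.to_subtype
    obtain ⟨y, hy⟩ := IsCompact.nonempty_iInter_of_directed_nonempty_isCompact_isClosed _ (hdir S)
      (fun i => hS i.1 i.2) (fun i => (hZc i.1).isCompact) fun i => hZc i.1
    rw [Set.mem_iInter] at hy
    exact ⟨y, fun i hi => Set.mem_iInter.1 (hy ⟨i, hi⟩) ⟨i, le_refl i⟩⟩
  have hstep : ∀ i, f i (x i) = 1 ∧ (Z i).Nonempty := by
    intro i
    induction i using WellFoundedLT.induction with
    | ind i ih =>
      obtain ⟨y, hy⟩ := hinter (Set.Iio i) fun j hj => (ih j hj).2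
      -- otherwise `x i` would be the only common zero of at most `μ` functions
      have hex : ∃ y, y ≠ x i ∧ ∀ j, j < i → f j y = 0 := by
        by_contra! hcon
        have hyx : y = x i := by
          by_contra hne
          obtain ⟨j, hj, hjy⟩ := hcon y hne
          exact hjy (hy j hj)
        refine (character_le_of_common_zero hμ (J := Set.Iio i) (p := x i)
          (Order.lt_succ_iff.1 (mk_Iio_ord_lt i)) (fun j => f j.1)
          (fun j => hyx ▸ hy j.1 j.2) fun z hz => ?_).not_gt (hchar (x i))
        by_contra hne
        obtain ⟨j, hj, hjz⟩ := hcon z hne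
        exact hjz (hz ⟨j, hj⟩)
      obtain ⟨h1, z, hz, hz'⟩ := hf i hex
      refine ⟨h1, z, Set.mem_iInter.2 fun j => ?_⟩
      rcases (show j.1 ≤ i from j.2).lt_or_eq with hj | hj
      · exact hz' j.1 hj
      · rw [hj]; exact hz
  obtain ⟨y, hy⟩ := hinter Set.univ fun i _ => (hstep i).2
  obtain ⟨i, rfl⟩ := hx y
  exact zero_ne_one ((hy i trivial).symm.trans (hstep i).1)

/-- Under GCH, the character of a homogeneous compactum is at most the maximum of its cellularity
and its π-character. -/
theorem IsHomogeneous.character_le_of_gch [T2Space X] (hGCH : GCH.{u}) (hX : IsHomogeneous X)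
    (p : X) : character p ≤ max (cellularity X) (piCharacter p) := by
  have : Nonempty X := ⟨p⟩
  let M := (max (cellularity X) (piCharacter p)).out
  have hM : #M = max (cellularity X) (piCharacter p) := mk_out _
  have h0 : ℵ₀ ≤ max (cellularity X) (piCharacter p) := le_max_of_le_left (le_max_left _ _)
  have : Infinite M := infinite_iff.2 (h0.trans_eq hM.symm)
  have hcard := hX.mk_le (M := M) (hM ▸ le_max_left _ _)
    fun x => hM ▸ (hX.piCharacter_eq x p).le.trans (le_max_right _ _)
  rw [hM, hGCH _ h0] at hcard
  obtain ⟨q, hq⟩ := exists_character_le h0 hcard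
  exact (hX.character_eq p q).trans_le hq

end SmallCharacter

/-! ### Noetherian type -/

theorem aleph0_le_cellularity (X : Type u) [TopologicalSpace X] : ℵ₀ ≤ cellularity X :=
  le_max_left _ _

/-- The three cases are: finite character; infinite character at most `c(X)`; and character above
`c(X)`, in which case it equals the π-character. -/
theorem IsHomogeneous.exists_isOpLike_cellularity (hGCH : GCH.{u}) {X : Type u}
    [TopologicalSpace X] [CompactSpace X] [T2Space X] (hX : IsHomogeneous X) (p : X) :
    ∃ 𝓑 : Set (Set X), IsNbhdBase {p} 𝓑 ∧ IsOpLike (cellularity X) 𝓑 := by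
  have h0 := aleph0_le_cellularity X
  rcases lt_or_ge (character p) ℵ₀ with hfin | hinf
  · obtain ⟨𝓑, hB, hc⟩ := exists_mk_eq_character p
    exact ⟨𝓑, hB, isOpLike_of_mk_lt (hc.trans_lt (hfin.trans_le h0))⟩
  rcases le_or_gt (character p) (cellularity X) with hle | hlt
  · obtain ⟨𝓑, hB, hop⟩ := exists_isOpLike_character p hinf
    exact ⟨𝓑, hB, hop.mono hle⟩
  have hπ : character p ≤ piCharacter p :=
    (le_max_iff.1 (hX.character_le_of_gch hGCH p)).resolve_left hlt.not_ge
  obtain ⟨𝓤, hU, hc⟩ := exists_mk_eq_character p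
  obtain ⟨𝓑, hB, hop⟩ := HasPointFiniteNbhds.exists_isOpLike hU
    (hX.hasPointFiniteNbhds (h0.trans_lt hlt)
      (fun q => hπ.trans (hX.piCharacter_eq p q).le) p hc)
  exact ⟨𝓑, hB, hop.mono h0⟩

end NoetherianType

theorem mainTheorem2 (hGCH : NoetherianType.GCH.{u})
    (X : Type u) [TopologicalSpace X] [CompactSpace X] [T2Space X]
    (hX : NoetherianType.IsHomogeneous X) :
    NoetherianType.localNoetherianType X ≤ NoetherianType.cellularity X ∧
      ∀ p : X, ∃ 𝓑 : Set (Set X), NoetherianType.IsNbhdBase {p} 𝓑 ∧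
        NoetherianType.IsOpLike (NoetherianType.cellularity X) 𝓑 := by
  have h := fun p : X => hX.exists_isOpLike_cellularity hGCH p
  exact ⟨ciSup_le' fun p => csInf_le' ⟨NoetherianType.aleph0_le_cellularity X, h p⟩, h⟩
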